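/- Let $p$ be an odd prime and let $\alpha,\beta\in\mathbb Z_p$. For $x\in\mathbb Z_p$ let $\langle x\rangle_p\in\{0,1,\dots,p-1\}$ be the least nonnegative residue of $x$ modulo $p$, and put $x^*=(x+\langle -x\rangle_p)/p\in\mathbb Z_p$. Let $\Gamma_p$ be Morita's $p$-adic Gamma function, i.e. $\Gamma_p(n)=(-1)^n\prod_{1\le k<n,\;p\nmid k}k$ for integers $n\ge 0$ (so $\Gamma_p(0)=1$), extended to $\mathbb Z_p$ by $\Gamma_p(x)=\lim_{n\in\mathbb N,\;|x-n|_p\to0}\Gamma_p(n)$. Let $${}_3F_2\bigg[\begin{matrix}\alpha&\beta&1-\alpha-\beta\\&1&1\end{matrix}\bigg|\,1\bigg]_{p-1}=\sum_{k=0}^{p-1}\frac{(\alpha)_k(\beta)_k(1-\alpha-\beta)_k}{(1)_k(1)_k\,k!},$$ where $(x)_k=x(x+1)\cdots(x+k-1)$ and $(x)_0=1$. (i) If $p\ne 3$ and $\langle-\alpha\rangle_p+\langle-\beta\rangle_p\le p-1$, then $${}_3F_2\bigg[\begin{matrix}\alpha&\beta&1-\alpha-\beta\\&1&1\end{matrix}\bigg|\,1\bigg]_{p-1}\equiv\frac{\Gamma_p(1-\alpha-\beta)^2}{\Gamma_p(1-\alpha)^2\,\Gamma_p(1-\beta)^2}\pmod{p^3}.$$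 (ii) If $\langle-\alpha\rangle_p+\langle-\beta\rangle_p\ge p$, then $${}_3F_2\bigg[\begin{matrix}\alpha&\beta&1-\alpha-\beta\\&1&1\end{matrix}\bigg|\,1\bigg]_{p-1}\equiv p^2\big((\alpha^*-1)^2+(\beta^*-1)^2+\alpha^*\beta^*-1\big)\cdot\frac{\Gamma_p(1-\alpha-\beta)^2}{\Gamma_p(1-\alpha)^2\,\Gamma_p(1-\beta)^2}\pmod{p^3}.$$ -/

import Mathlib

/-- The truncated hypergeometric series
`∑_{k=0}^{n} (a₀)_k ⋯ (a_r)_k / ((b₁)_k ⋯ (b_r)_k) * z^k / k!`. -/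
noncomputable def truncHypergeometric {K : Type*} [Field K] {r : ℕ}
    (a : Fin (r + 1) → K) (b : Fin r → K) (z : K) (n : ℕ) : K :=
  ∑ k ∈ Finset.range (n + 1),
    (∏ i, (ascPochhammer K k).eval (a i)) / (∏ j, (ascPochhammer K k).eval (b j)) *
      (z ^ k / (k.factorial : K))

/-- Morita's function at natural numbers: `(-1)^n ∏_{1 ≤ k < n, p ∤ k} k`
(which is `1` at `n = 0`). -/
def moritaGammaNat (p n : ℕ) : ℤ :=
  (-1) ^ n * ∏ k ∈ Finset.Ico 1 n with ¬ p ∣ k, (k : ℤ)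

/-- Morita's `p`-adic Gamma function: the limit of `moritaGammaNat p n` as the natural number `n`
tends `p`-adically to `x`. -/
noncomputable def moritaGamma (p : ℕ) [Fact p.Prime] (x : ℤ_[p]) : ℤ_[p] :=
  Filter.limUnder (Filter.comap (fun n : ℕ => (n : ℤ_[p])) (nhds x))
    (fun n : ℕ => (moritaGammaNat p n : ℤ_[p]))

/-- `x* = (x + ⟨-x⟩_p) / p`, where `⟨y⟩_p = y.zmodRepr` is the least nonnegative residue. -/
noncomputable def padicDash {p : ℕ} [Fact p.Prime] (x : ℤ_[p]) : ℚ_[p] :=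
  ((x : ℚ_[p]) + ((-x).zmodRepr : ℚ_[p])) / (p : ℚ_[p])

/-- `x ≡ y (mod p^n)`: the difference lies in `p^n ℤ_p`. -/
def PadicCongrMod {p : ℕ} [Fact p.Prime] (n : ℕ) (x y : ℚ_[p]) : Prop :=
  ∃ z : ℤ_[p], x - y = (p : ℚ_[p]) ^ n * (z : ℚ_[p])

open Finset Filter Topology

/-! Write `α = -a + p x`, `β = -b + p y` with `0 ≤ a, b < p`, and `γ = 1 - α - β`. Modulo `p ^ 3`
both sides are quadratic polynomials in `p x` and `p y`: the sum because it is built from affine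
functions, the Gamma side by a second-order Taylor expansion (`moritaGamma_taylor`). Such a
polynomial is determined by its values on the axes `x = 0`, `y = 0` and at one point with `x y` a
unit (`dvd_of_mem_quadraticModCube`).

At those points one of `α`, `β`, `γ` is an integer in `(-p, 0]`, so the sum terminates and
Pfaff–Saalschütz (`sum_saalschutz`) evaluates it exactly. The result is a squared product that turns
into Gamma values, times `(p (1 - y)) ^ 2` when one factor of the product is divisible by `p`.
Reflection puts the Gamma quotient in the form `(Γ(α) Γ(β) Γ(γ)) ^ 2`, symmetric in the three
parameters, so the same evaluation serves all three. -/

/-! ### Pfaff–Saalschütz summation. -/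

/-- A Zeilberger-type certificate: the combination of the summands at `a + 1` and at `a` telescopes.
The boundary term contains `(-a)_n`, so for a natural number `a < n` it becomes a first-order
recurrence in `a`. -/
theorem sum_saalschutz_telescope {K : Type*} [Field K] [CharZero K] (a b : K) (n : ℕ) :
    ∑ k ∈ range (n + 1),
      ((a + 1) ^ 2 * ((ascPochhammer K k).eval (-(a + 1)) * (ascPochhammer K k).eval b *
          (ascPochhammer K k).eval (2 + a - b) / (k.factorial : K) ^ 3) -
        (1 + a - b) ^ 2 * ((ascPochhammer K k).eval (-a) * (ascPochhammer K k).eval b *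
          (ascPochhammer K k).eval (1 + a - b) / (k.factorial : K) ^ 3)) =
      (2 + 2 * a - b) * (ascPochhammer K n).eval (-a) * (ascPochhammer K (n + 1)).eval b *
        (ascPochhammer K n).eval (2 + a - b) / (n.factorial : K) ^ 3 := by
  have shift : ∀ (x : K) (k : ℕ), (ascPochhammer K (k + 1)).eval x =
      x * (ascPochhammer K k).eval (x + 1) := by
    intro x k
    simp [ascPochhammer_succ_left]
  induction n with
  | zero => simp; ring
  | succ n ih =>
    rw [sum_range_succ, ih, shift (-(a + 1)), shift (1 + a - b),
      show -(a + 1) + 1 = -a by ring, show 1 + a - b + 1 = 2 + a - b by ring,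
      ascPochhammer_succ_eval (n + 1) b, ascPochhammer_succ_eval n (-a),
      ascPochhammer_succ_eval n (2 + a - b), Nat.factorial_succ]
    have h1 : (n.factorial : K) ≠ 0 := by exact_mod_cast n.factorial_ne_zero
    have h2 : (n + 1 : K) ≠ 0 := by exact_mod_cast n.succ_ne_zero
    push_cast
    field_simp
    ring

/-- The Pfaff–Saalschütz summation with both lower parameters equal to `1`. -/
theorem sum_saalschutz {K : Type*} [Field K] [CharZero K] (b : K) {a n : ℕ} (h : a < n) :
    ∑ k ∈ range n, (ascPochhammer K k).eval (-(a : K)) * (ascPochhammer K k).eval b *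
        (ascPochhammer K k).eval (1 + a - b) / (k.factorial : K) ^ 3 =
      ((ascPochhammer K a).eval (1 - b) / (a.factorial : K)) ^ 2 := by
  induction a with
  | zero =>
    obtain ⟨m, rfl⟩ : ∃ m, n = m + 1 := ⟨n - 1, by omega⟩
    rw [sum_range_succ', sum_eq_zero]
    · simp
    · intro k _
      simp [ascPochhammer_succ_left]
  | succ a ih =>
    obtain ⟨m, rfl⟩ : ∃ m, n = m + 1 := ⟨n - 1, by omega⟩
    have key := sum_saalschutz_telescope (a : K) b m
    -- Here `a < m`, so the boundary term of the telescoped sum vanishes.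
    have hz : (ascPochhammer K m).eval (-(a : K)) = 0 :=
      ascPochhammer_eval_neg_coe_nat_of_lt (by omega)
    rw [sum_sub_distrib, ← mul_sum, ← mul_sum, ih (by omega), hz] at key
    have h2 : (a + 1 : K) ≠ 0 := by exact_mod_cast a.succ_ne_zero
    have h1 : (a.factorial : K) ≠ 0 := by exact_mod_cast a.factorial_ne_zero
    have e : (1 + ((a + 1 : ℕ) : K) - b) = 2 + a - b := by push_cast; ring
    rw [e, Nat.factorial_succ, ascPochhammer_succ_eval]
    push_cast
    have h3 : ((a : K) + 1) ^ 2 ≠ 0 := pow_ne_zero _ h2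
    apply mul_left_cancel₀ h3
    simp only [mul_zero, zero_mul, zero_div] at key
    rw [sub_eq_zero.mp key]
    field_simp
    ring

/-! ### Wilson's theorem modulo odd prime powers. -/

theorem ZMod.sq_eq_one_iff_of_odd_prime_pow {p : ℕ} [Fact p.Prime] (hp : Odd p) (n : ℕ)
    (u : ZMod (p ^ n)) : u ^ 2 = 1 ↔ u = 1 ∨ u = -1 := by
  refine ⟨fun h => ?_, by rintro (rfl | rfl) <;> simp⟩
  have pp : Prime (p : ℤ) := Nat.prime_iff_prime_int.mp Fact.out
  obtain ⟨k, rfl⟩ := ZMod.intCast_surjective u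
  have h' : ((p : ℤ) ^ n) ∣ (k - 1) * (k + 1) := by
    have : (((k - 1) * (k + 1) : ℤ) : ZMod (p ^ n)) = 0 := by
      push_cast; linear_combination h
    rw [ZMod.intCast_zmod_eq_zero_iff_dvd] at this
    exact_mod_cast this
  have two : ¬ (p : ℤ) ∣ 2 := by
    intro h2
    have : p ∣ 2 := by exact_mod_cast h2
    have := (Nat.prime_dvd_prime_iff_eq Fact.out Nat.prime_two).mp this
    subst this
    exact absurd hp (by decide)
  by_cases hk : (p : ℤ) ∣ k - 1
  · left
    have hk' : ¬ (p : ℤ) ∣ k + 1 := fun h3 => two (by have := dvd_sub h3 hk; ring_nf at this; exact this)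
    have := pp.pow_dvd_of_dvd_mul_right n hk' h'
    have : ((k - 1 : ℤ) : ZMod (p ^ n)) = 0 := by
      rw [ZMod.intCast_zmod_eq_zero_iff_dvd]; exact_mod_cast this
    push_cast at this; linear_combination this
  · right
    have := pp.pow_dvd_of_dvd_mul_left n hk h'
    have : ((k + 1 : ℤ) : ZMod (p ^ n)) = 0 := by
      rw [ZMod.intCast_zmod_eq_zero_iff_dvd]; exact_mod_cast this
    push_cast at this; linear_combination this

theorem ZMod.prod_univ_units_of_odd_prime_pow {p : ℕ} [Fact p.Prime] (hp : Odd p) (n : ℕ) :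
    ∏ u : (ZMod (p ^ n))ˣ, (u : ZMod (p ^ n)) = -1 := by
  classical
  -- Units cancel against their inverses; once `-1` is removed, the only possible self-inverse unit
  -- is `1`, which contributes nothing.
  have : (∏ u ∈ (univ : Finset (ZMod (p ^ n))ˣ).erase (-1), u) = 1 := by
    refine prod_involution (fun u _ => u⁻¹) (by simp) (fun u hu hne heq => ?_)
      (fun u hu => ?_) (by simp)
    · have h1 : (u : ZMod (p ^ n)) ^ 2 = 1 := by
        have : u * u = 1 := by nth_rewrite 1 [← heq]; simp
        simpa [sq] using congrArg Units.val this
      rcases (ZMod.sq_eq_one_iff_of_odd_prime_pow hp n _).mp h1 with h | h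
      · exact hne (Units.ext h)
      · exact (mem_erase.mp hu).1 (Units.ext (by simpa using h))
    · refine mem_erase.mpr ⟨fun h => (mem_erase.mp hu).1 ?_, mem_univ _⟩
      rw [← inv_inv u, h]; simp
  have h2 := Finset.mul_prod_erase (univ : Finset (ZMod (p ^ n))ˣ) (fun u => u) (mem_univ (-1))
  rw [this, mul_one] at h2
  have := congrArg Units.val h2
  simpa using this.symm

theorem ZMod.prod_range_natCast {M : Type*} [CommMonoid M] (n : ℕ) [NeZero n] (f : ZMod n → M) :
    ∏ i ∈ range n, f (i : ZMod n) = ∏ x : ZMod n, f x := by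
  refine prod_bij (fun i _ => (i : ZMod n)) (by simp) (fun i hi j hj h => ?_) (fun x _ => ?_)
    (by simp)
  · rw [mem_range] at hi hj
    have := (ZMod.natCast_eq_natCast_iff' i j n).mp h
    rwa [Nat.mod_eq_of_lt hi, Nat.mod_eq_of_lt hj] at this
  · exact ⟨x.val, mem_range.mpr x.val_lt, by simp⟩

/-! ### Morita's function on the natural numbers. -/

theorem moritaGammaNat_zero (p : ℕ) : moritaGammaNat p 0 = 1 := by simp [moritaGammaNat]

theorem moritaGammaNat_succ (p n : ℕ) :
    moritaGammaNat p (n + 1) = -(if p ∣ n then 1 else (n : ℤ)) * moritaGammaNat p n := by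
  rcases Nat.eq_zero_or_pos n with rfl | hn
  · simp [moritaGammaNat]
  · simp only [moritaGammaNat, prod_filter]
    rw [prod_Ico_succ_top hn]
    by_cases h : p ∣ n <;> simp [h] <;> ring

theorem moritaGammaNat_add (p n m : ℕ) :
    moritaGammaNat p (n + m) =
      (-1) ^ m * (∏ i ∈ range m, if p ∣ n + i then 1 else ((n + i : ℕ) : ℤ)) *
        moritaGammaNat p n := by
  induction m with
  | zero => simp
  | succ m ih => rw [← add_assoc, moritaGammaNat_succ, ih, prod_range_succ]; ring

/-- The `p ^ N` new factors run once through the units modulo `p ^ N`; their product `-1` cancels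
the sign `(-1) ^ (p ^ N) = -1`. -/
theorem moritaGammaNat_add_prime_pow {p : ℕ} [Fact p.Prime] (hp : Odd p) (n N : ℕ) :
    (moritaGammaNat p (n + p ^ N) : ZMod (p ^ N)) = moritaGammaNat p n := by
  classical
  rcases Nat.eq_zero_or_pos N with rfl | hN
  · exact (ZMod.subsingleton_iff (n := p ^ 0)).mpr (by simp) |>.elim _ _
  have hpN : NeZero (p ^ N) := ⟨pow_ne_zero _ (Fact.out : p.Prime).ne_zero⟩
  let f : ZMod (p ^ N) → ZMod (p ^ N) := fun x => if IsUnit x then x else 1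
  have hf : ∀ i : ℕ, (((if p ∣ n + i then 1 else ((n + i : ℕ) : ℤ)) : ℤ) : ZMod (p ^ N)) =
      f (n + (i : ZMod (p ^ N))) := by
    intro i
    have : IsUnit ((n : ZMod (p ^ N)) + (i : ZMod (p ^ N))) ↔ ¬ p ∣ n + i := by
      rw [← Nat.cast_add, ZMod.isUnit_iff_coprime, Nat.coprime_pow_right_iff hN,
        Nat.coprime_comm, (Fact.out : p.Prime).coprime_iff_not_dvd]
    by_cases h : p ∣ n + i <;> simp [f, this, h]
  have hprod : ∏ x : ZMod (p ^ N), f x = -1 := by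
    rw [← ZMod.prod_univ_units_of_odd_prime_pow hp N]
    simp only [f]
    rw [← prod_filter]
    symm
    refine prod_bij (fun u _ => (u : ZMod (p ^ N))) (by simp) (fun u _ v _ h => Units.ext h)
      (fun x hx => ?_) (by simp)
    obtain ⟨u, rfl⟩ := (mem_filter.mp hx).2
    exact ⟨u, mem_univ _, rfl⟩
  rw [moritaGammaNat_add]
  rw [Int.cast_mul, Int.cast_mul, Int.cast_prod, prod_congr rfl fun i _ => hf i]
  push_cast
  rw [ZMod.prod_range_natCast (p ^ N) (fun x => f (n + x)),
    Fintype.prod_equiv (Equiv.addLeft (n : ZMod (p ^ N))) _ f (fun x => by simp), hprod, (hp.pow).neg_one_pow]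
  ring

theorem PadicInt.natCast_pow_dvd_intCast_iff {p : ℕ} [Fact p.Prime] (N : ℕ) (k : ℤ) :
    (p : ℤ_[p]) ^ N ∣ (k : ℤ_[p]) ↔ (k : ZMod (p ^ N)) = 0 := by
  rw [← Ideal.mem_span_singleton, ← PadicInt.ker_toZModPow, RingHom.mem_ker, map_intCast]

/-! ### The Gamma function on `ℤ_[p]`: continuity, functional equation, reflection. -/

section MoritaGamma

variable {p : ℕ} [Fact p.Prime]

theorem PadicInt.dvd_iff_dist_le (N : ℕ) (x y : ℤ_[p]) :
    (p : ℤ_[p]) ^ N ∣ x - y ↔ dist x y ≤ (p : ℝ) ^ (-(N : ℤ)) := by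
  rw [dist_eq_norm, PadicInt.norm_le_pow_iff_mem_span_pow, Ideal.mem_span_singleton]

theorem PadicInt.exists_natCast_sub_dvd (N : ℕ) (x : ℤ_[p]) :
    ∃ n : ℕ, (p : ℤ_[p]) ^ N ∣ x - n :=
  ⟨x.appr N, Ideal.mem_span_singleton.mp (PadicInt.appr_spec N x)⟩

theorem PadicInt.eq_of_forall_pow_dvd {x y : ℤ_[p]} (h : ∀ N, (p : ℤ_[p]) ^ N ∣ x - y) :
    x = y := by
  refine PadicInt.ext_of_toZModPow.mp fun N => ?_
  have := h N
  rwa [← Ideal.mem_span_singleton, ← PadicInt.ker_toZModPow, RingHom.mem_ker, map_sub,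
    sub_eq_zero] at this

theorem moritaGammaNat_congr (hp : Odd p) (N : ℕ) {m n : ℕ}
    (h : (p : ℤ_[p]) ^ N ∣ (m : ℤ_[p]) - n) :
    (p : ℤ_[p]) ^ N ∣ (moritaGammaNat p m : ℤ_[p]) - moritaGammaNat p n := by
  wlog hmn : n ≤ m generalizing m n
  · rw [← dvd_neg, neg_sub]
    exact this (by rwa [← dvd_neg, neg_sub]) (by omega)
  have hd : p ^ N ∣ m - n := by
    have := (PadicInt.natCast_pow_dvd_intCast_iff (p := p) N (((m - n : ℕ) : ℤ))).mp (by
      rw [Int.cast_natCast, Nat.cast_sub hmn]; exact h)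
    rwa [Int.cast_natCast, ZMod.natCast_eq_zero_iff] at this
  obtain ⟨d, hd⟩ := hd
  obtain rfl : m = n + p ^ N * d := by omega
  have : (moritaGammaNat p (n + p ^ N * d) : ZMod (p ^ N)) = moritaGammaNat p n := by
    clear h hmn hd
    induction d with
    | zero => simp
    | succ d ih => rw [mul_add, mul_one, ← add_assoc, moritaGammaNat_add_prime_pow hp, ih]
  have h2 := (PadicInt.natCast_pow_dvd_intCast_iff (p := p) N
    (moritaGammaNat p (n + p ^ N * d) - moritaGammaNat p n)).mpr (by simp [this])
  simpa using h2

theorem comap_natCast_nhds_neBot (x : ℤ_[p]) :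
    NeBot (comap (fun n : ℕ => (n : ℤ_[p])) (𝓝 x)) :=
  comap_neBot fun t ht => by
    obtain ⟨_, h, n, rfl⟩ := mem_closure_iff_nhds.mp (PadicInt.denseRange_natCast x) t ht
    exact ⟨n, h⟩

/-- `limUnder` is meaningful only if the limit exists; `moritaGammaNat_congr` makes the image filter
Cauchy, and `ℤ_[p]` is complete. -/
theorem moritaGamma_tendsto (hp : Odd p) (x : ℤ_[p]) :
    Tendsto (fun n : ℕ => (moritaGammaNat p n : ℤ_[p]))
      (comap (fun n : ℕ => (n : ℤ_[p])) (𝓝 x)) (𝓝 (moritaGamma p x)) := by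
  have hne : NeBot (comap (fun n : ℕ => (n : ℤ_[p])) (𝓝 x)) :=
    comap_natCast_nhds_neBot x
  apply tendsto_nhds_limUnder
  have : Cauchy (map (fun n : ℕ => (moritaGammaNat p n : ℤ_[p]))
      (comap (fun n : ℕ => (n : ℤ_[p])) (𝓝 x))) := by
    rw [Metric.cauchy_iff]
    refine ⟨hne.map _, fun ε hε => ?_⟩
    obtain ⟨N, hN⟩ := PadicInt.exists_pow_neg_lt p hε
    refine ⟨(fun n : ℕ => (moritaGammaNat p n : ℤ_[p])) ''
      ((fun n : ℕ => (n : ℤ_[p])) ⁻¹' Metric.closedBall x ((p : ℝ) ^ (-(N : ℤ)))),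
      image_mem_map (preimage_mem_comap (Metric.closedBall_mem_nhds x ?_)), ?_⟩
    · have : 0 < (p : ℝ) := by exact_mod_cast (Fact.out : p.Prime).pos
      positivity
    · rintro _ ⟨m, hm, rfl⟩ _ ⟨n, hn, rfl⟩
      refine lt_of_le_of_lt ?_ hN
      rw [← PadicInt.dvd_iff_dist_le]
      apply moritaGammaNat_congr hp
      rw [Set.mem_preimage, Metric.mem_closedBall, ← PadicInt.dvd_iff_dist_le] at hm hn
      have := dvd_sub hm hn
      simpa using this
  obtain ⟨y, hy⟩ := CompleteSpace.complete this
  exact ⟨y, hy⟩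

theorem moritaGamma_congr_nat (hp : Odd p) (N : ℕ) {x : ℤ_[p]} {n : ℕ}
    (h : (p : ℤ_[p]) ^ N ∣ x - n) :
    (p : ℤ_[p]) ^ N ∣ moritaGamma p x - moritaGammaNat p n := by
  have hne : NeBot (comap (fun n : ℕ => (n : ℤ_[p])) (𝓝 x)) :=
    comap_natCast_nhds_neBot x
  have hpos : 0 < (p : ℝ) := by exact_mod_cast (Fact.out : p.Prime).pos
  rw [PadicInt.dvd_iff_dist_le]
  refine le_of_tendsto ((moritaGamma_tendsto hp x).dist tendsto_const_nhds) ?_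
  filter_upwards [preimage_mem_comap (Metric.closedBall_mem_nhds x
    (by positivity : 0 < (p : ℝ) ^ (-(N : ℤ))))] with m hm
  rw [Set.mem_preimage, Metric.mem_closedBall, ← PadicInt.dvd_iff_dist_le] at hm
  rw [← PadicInt.dvd_iff_dist_le]
  apply moritaGammaNat_congr hp
  have := dvd_add hm h
  simpa using this

theorem moritaGamma_natCast (hp : Odd p) (n : ℕ) :
    moritaGamma p (n : ℤ_[p]) = moritaGammaNat p n :=
  PadicInt.eq_of_forall_pow_dvd fun N => moritaGamma_congr_nat hp N (by simp)

theorem moritaGamma_congr (hp : Odd p) (N : ℕ) {x y : ℤ_[p]} (h : (p : ℤ_[p]) ^ N ∣ x - y) :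
    (p : ℤ_[p]) ^ N ∣ moritaGamma p x - moritaGamma p y := by
  obtain ⟨n, hn⟩ := PadicInt.exists_natCast_sub_dvd N y
  have hx : (p : ℤ_[p]) ^ N ∣ x - n := by simpa using dvd_add h hn
  simpa using dvd_sub (moritaGamma_congr_nat hp N hx) (moritaGamma_congr_nat hp N hn)

open Classical in
/-- The factor `x` when `p ∤ x`, and `1` otherwise. -/
noncomputable def primeToPart (x : ℤ_[p]) : ℤ_[p] := if (p : ℤ_[p]) ∣ x then 1 else x

theorem primeToPart_of_dvd {x : ℤ_[p]} (h : (p : ℤ_[p]) ∣ x) : primeToPart x = 1 := by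
  simp [primeToPart, h]

theorem primeToPart_of_not_dvd {x : ℤ_[p]} (h : ¬ (p : ℤ_[p]) ∣ x) : primeToPart x = x := by
  simp [primeToPart, h]

theorem primeToPart_neg_sq (x : ℤ_[p]) : primeToPart (-x) ^ 2 = primeToPart x ^ 2 := by
  by_cases h : (p : ℤ_[p]) ∣ x <;> simp [primeToPart, h]

theorem primeToPart_congr {N : ℕ} (hN : N ≠ 0) {x y : ℤ_[p]} (h : (p : ℤ_[p]) ^ N ∣ x - y) :
    (p : ℤ_[p]) ^ N ∣ primeToPart x - primeToPart y := by
  have h1 : (p : ℤ_[p]) ∣ x - y := (dvd_pow_self _ hN).trans h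
  by_cases hy : (p : ℤ_[p]) ∣ y
  · have hx : (p : ℤ_[p]) ∣ x := by simpa using dvd_add h1 hy
    simp [primeToPart, hx, hy]
  · have hx : ¬ (p : ℤ_[p]) ∣ x := fun hx => hy (by simpa using dvd_sub hx h1)
    simpa [primeToPart, hx, hy] using h

theorem PadicInt.prime_dvd_natCast_iff (n : ℕ) : (p : ℤ_[p]) ∣ (n : ℤ_[p]) ↔ p ∣ n := by
  have := PadicInt.natCast_pow_dvd_intCast_iff (p := p) 1 (n : ℤ)
  rw [pow_one, Int.cast_natCast, Int.cast_natCast, ZMod.natCast_eq_zero_iff, pow_one] at this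
  exact this

theorem moritaGamma_add_one (hp : Odd p) (x : ℤ_[p]) :
    moritaGamma p (x + 1) = -primeToPart x * moritaGamma p x := by
  have hnat : ∀ n : ℕ, moritaGamma p ((n : ℤ_[p]) + 1) =
      -primeToPart (n : ℤ_[p]) * moritaGamma p n := by
    intro n
    rw [← Nat.cast_succ, moritaGamma_natCast hp, moritaGamma_natCast hp, moritaGammaNat_succ]
    by_cases h : p ∣ n <;> simp [primeToPart, PadicInt.prime_dvd_natCast_iff, h]
  refine PadicInt.eq_of_forall_pow_dvd fun N => ?_
  -- The exponent is `N + 1` because `primeToPart` respects congruences only modulo positive powers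
  -- of `p`.
  obtain ⟨n, hn⟩ := PadicInt.exists_natCast_sub_dvd (N + 1) x
  refine (pow_dvd_pow _ (Nat.le_add_right N 1)).trans ?_
  have h1 := moritaGamma_congr hp (N + 1) (x := x + 1) (y := n + 1) (by simpa using hn)
  obtain ⟨u, hu⟩ := h1
  obtain ⟨v, hv⟩ := moritaGamma_congr hp (N + 1) hn
  obtain ⟨w, hw⟩ := primeToPart_congr (N := N + 1) N.succ_ne_zero hn
  refine ⟨u + w * moritaGamma p x + primeToPart n * v, ?_⟩
  linear_combination hu + hnat n + hw * moritaGamma p x + primeToPart (n : ℤ_[p]) * hv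

theorem moritaGamma_add_natCast (hp : Odd p) (x : ℤ_[p]) (n : ℕ) :
    moritaGamma p (x + n) = (-1) ^ n * (∏ i ∈ range n, primeToPart (x + (i : ℤ_[p]))) *
      moritaGamma p x := by
  induction n with
  | zero => simp
  | succ n ih =>
    rw [Nat.cast_succ, ← add_assoc, moritaGamma_add_one hp, ih, prod_range_succ]; ring

theorem moritaGamma_zero (hp : Odd p) : moritaGamma p (0 : ℤ_[p]) = 1 := by
  simpa [moritaGammaNat_zero] using moritaGamma_natCast (p := p) hp 0

/-- The reflection formula, up to sign. -/
theorem moritaGamma_sq_mul_sq (hp : Odd p) (x : ℤ_[p]) :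
    moritaGamma p x ^ 2 * moritaGamma p (1 - x) ^ 2 = 1 := by
  -- Induction by the functional equation at `n` and at `-n`: the two factors differ by a sign at
  -- most, which the squares remove. Approximation by naturals then gives all `x`.
  have hnat : ∀ n : ℕ, moritaGamma p (n : ℤ_[p]) ^ 2 * moritaGamma p (1 - n) ^ 2 = 1 := by
    intro n
    induction n with
    | zero =>
      have := moritaGamma_add_one (p := p) hp 0
      simp [primeToPart, moritaGamma_zero hp] at this
      simp [this, moritaGamma_zero hp]
    | succ n ih =>
      have h1 := moritaGamma_add_one (p := p) hp n
      have h2 := moritaGamma_add_one (p := p) hp (-n)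
      have h3 := primeToPart_neg_sq (p := p) n
      rw [show (-(n : ℤ_[p]) + 1) = 1 - n by ring] at h2
      rw [Nat.cast_succ, h1, show (1 - ((n : ℤ_[p]) + 1)) = -n by ring]
      rw [h2] at ih
      linear_combination ih - h3 * moritaGamma p n ^ 2 * moritaGamma p (-n) ^ 2
  refine PadicInt.eq_of_forall_pow_dvd fun N => ?_
  obtain ⟨n, hn⟩ := PadicInt.exists_natCast_sub_dvd N x
  obtain ⟨u, hu⟩ := moritaGamma_congr hp N hn
  obtain ⟨v, hv⟩ := moritaGamma_congr hp N (x := 1 - x) (y := 1 - n) (by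
    rw [← dvd_neg]; simpa using hn)
  have := hnat n
  set A := moritaGamma p x
  set B := moritaGamma p (1 - x)
  set C := moritaGamma p (n : ℤ_[p])
  set D := moritaGamma p (1 - (n : ℤ_[p]))
  refine ⟨u * (A + C) * B ^ 2 + C ^ 2 * v * (B + D), ?_⟩
  linear_combination this + hu * (A + C) * B ^ 2 + C ^ 2 * hv * (B + D)

end MoritaGamma

/-! ### Taylor expansion of the Gamma function modulo `p ^ 3`. -/

section

variable {p : ℕ} [Fact p.Prime]

open Polynomial in
-- The shifts `m + k` meet each residue once, and the factors `X + x` over all residues give `X ^ p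
-- - X`; omitting `x = 0` divides this by `X`.
theorem ZMod.prod_X_add_C_ne_zero [DecidableEq (ZMod p)] (m : ZMod p) :
    ∏ k ∈ range p, (if m + (k : ZMod p) = 0 then 1 else X + C (m + (k : ZMod p))) =
      X ^ (p - 1) - (1 : (ZMod p)[X]) := by
  have hp : p.Prime := Fact.out
  have all : ∏ x : ZMod p, (X + C x) = X ^ p - (X : (ZMod p)[X]) := by
    have hr := FiniteField.roots_X_pow_card_sub_X (ZMod p)
    rw [ZMod.card] at hr
    have hm : (X ^ p - X : (ZMod p)[X]).Monic := monic_X_pow_sub (by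
      rw [degree_X]; exact_mod_cast hp.one_lt)
    have := prod_multiset_X_sub_C_of_monic_of_roots_card_eq hm (by
      rw [hr, FiniteField.X_pow_card_sub_X_natDegree_eq _ hp.one_lt]; simp [ZMod.card])
    rw [hr] at this
    rw [← this, Fintype.prod_equiv (Equiv.neg (ZMod p)) _ (fun x => X - C x) (fun x => by simp)]
    rfl
  rw [ZMod.prod_range_natCast p (fun x => if m + x = 0 then 1 else X + C (m + x)),
    Fintype.prod_equiv (Equiv.addLeft m) _ (fun x => if x = 0 then 1 else X + C x)
      (fun x => by simp)]
  rw [← mul_prod_erase univ _ (mem_univ (0 : ZMod p))] at all ⊢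
  rw [if_pos rfl, one_mul, prod_congr rfl fun x hx => if_neg (mem_erase.mp hx).1]
  apply mul_left_cancel₀ (X_ne_zero : (X : (ZMod p)[X]) ≠ 0)
  rw [C_0, add_zero] at all
  rw [all, mul_sub, ← pow_succ', Nat.sub_add_cancel hp.one_le, mul_one]

theorem PadicInt.toZMod_eq_zero_iff_dvd (x : ℤ_[p]) : PadicInt.toZMod x = 0 ↔ (p : ℤ_[p]) ∣ x := by
  rw [← RingHom.mem_ker, PadicInt.ker_toZMod, PadicInt.maximalIdeal_eq_span_p,
    Ideal.mem_span_singleton]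

open Polynomial in
theorem Polynomial.eval_mul_congr_cube {R : Type*} [CommRing R] (P : R[X]) {q c d : R}
    (h1 : P.coeff 1 = q * c) (h2 : P.coeff 2 = q * d) (z : R) :
    q ^ 3 ∣ P.eval (q * z) - (P.coeff 0 + q ^ 2 * c * z) := by
  have e0 := congrArg (eval (q * z)) (divX_mul_X_add P)
  have e1 := congrArg (eval (q * z)) (divX_mul_X_add P.divX)
  have e2 := congrArg (eval (q * z)) (divX_mul_X_add P.divX.divX)
  simp only [eval_add, eval_mul, eval_X, eval_C, coeff_divX, zero_add, Nat.reduceAdd, h1, h2]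
    at e0 e1 e2
  refine ⟨d * z ^ 2 + z ^ 3 * eval (q * z) P.divX.divX.divX, ?_⟩
  linear_combination -e0 - e1 * (q * z) - e2 * (q * z) ^ 2

open Polynomial in
-- The functional equation, applied `p` times, multiplies by `-P(p z)`, where `P` reduces to `X ^ (p
-- - 1) - 1` modulo `p`. For `p ≥ 5` its coefficients of degree 1 and 2 are divisible by `p`, so
-- modulo `p ^ 3` only a linear term in `z` with coefficient divisible by `p ^ 2` survives. For `p =
-- 3` the coefficient of degree 2 is a unit.
theorem moritaGamma_add_prime (hp : Odd p) (hp5 : 5 ≤ p) (m : ℤ_[p]) :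
    ∃ w c : ℤ_[p], ∀ z : ℤ_[p], (p : ℤ_[p]) ^ 3 ∣
      moritaGamma p (m + p * (z + 1)) - (1 + p * w + p ^ 2 * c * z) * moritaGamma p (m + p * z) := by
  classical
  let P : ℤ_[p][X] := ∏ k ∈ range p,
    if (p : ℤ_[p]) ∣ m + (k : ℤ_[p]) then 1 else X + C (m + (k : ℤ_[p]))
  have hP : P.map PadicInt.toZMod = X ^ (p - 1) - 1 := by
    rw [← ZMod.prod_X_add_C_ne_zero (PadicInt.toZMod m), Polynomial.map_prod]
    refine prod_congr rfl fun k _ => ?_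
    rw [← PadicInt.toZMod_eq_zero_iff_dvd, map_add, map_natCast]
    split_ifs <;> simp
  have heval : ∀ z : ℤ_[p], ∏ i ∈ range p, primeToPart (m + (p : ℤ_[p]) * z + (i : ℤ_[p])) =
      P.eval (p * z) := by
    intro z
    rw [eval_prod]
    refine prod_congr rfl fun k _ => ?_
    have : (p : ℤ_[p]) ∣ m + p * z + (k : ℤ_[p]) ↔ (p : ℤ_[p]) ∣ m + (k : ℤ_[p]) := by
      rw [show m + p * z + (k : ℤ_[p]) = (m + k) + p * z by ring]
      exact dvd_add_left (dvd_mul_right _ _)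
    by_cases h : (p : ℤ_[p]) ∣ m + (k : ℤ_[p])
    · simp [primeToPart, this, h]
    · simp [primeToPart, this, h]; ring
  have hcoeff : ∀ i, PadicInt.toZMod (P.coeff i) = (X ^ (p - 1) - 1 : (ZMod p)[X]).coeff i := by
    intro i; rw [← hP, coeff_map]
  obtain ⟨c, hc⟩ := (PadicInt.toZMod_eq_zero_iff_dvd (P.coeff 1)).mp (by
    rw [hcoeff, coeff_sub, coeff_X_pow, coeff_one, if_neg (by omega), if_neg (by omega), sub_zero])
  obtain ⟨d, hd⟩ := (PadicInt.toZMod_eq_zero_iff_dvd (P.coeff 2)).mp (by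
    rw [hcoeff, coeff_sub, coeff_X_pow, coeff_one, if_neg (by omega), if_neg (by omega), sub_zero])
  obtain ⟨w, hw⟩ := (PadicInt.toZMod_eq_zero_iff_dvd (P.coeff 0 + 1)).mp (by
    rw [map_add, hcoeff, coeff_sub, coeff_X_pow, coeff_one, if_neg (by omega), if_pos rfl]; simp)
  refine ⟨-w, -c, fun z => ?_⟩
  have hΓ := moritaGamma_add_natCast hp (m + p * z) p
  rw [heval, hp.neg_one_pow] at hΓ
  obtain ⟨r, hr⟩ := P.eval_mul_congr_cube hc hd z
  refine ⟨-r * moritaGamma p (m + p * z), ?_⟩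
  rw [show m + (p : ℤ_[p]) * (z + 1) = m + p * z + p by ring, hΓ]
  linear_combination (-hr - hw) * moritaGamma p (m + p * z)

theorem PadicInt.isUnit_natCast_iff (n : ℕ) : IsUnit (n : ℤ_[p]) ↔ ¬ p ∣ n := by
  rw [← PadicInt.prime_dvd_natCast_iff, PadicInt.isUnit_iff, ← PadicInt.norm_lt_one_iff_dvd,
    not_lt, le_antisymm_iff, and_iff_right (PadicInt.norm_le_one _)]

theorem PadicInt.isUnit_two (hp : Odd p) : IsUnit (2 : ℤ_[p]) := by
  refine (PadicInt.isUnit_natCast_iff 2).mpr fun h => ?_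
  rw [Nat.prime_dvd_prime_iff_eq Fact.out Nat.prime_two] at h
  subst h
  exact absurd hp (by decide)

/-- The second-order Taylor expansion of the `p`-adic Gamma function modulo `p ^ 3`. -/
theorem moritaGamma_taylor (hp : Odd p) (hp5 : 5 ≤ p) (m : ℤ_[p]) :
    ∃ A B : ℤ_[p], ∀ z : ℤ_[p], (p : ℤ_[p]) ^ 3 ∣
      moritaGamma p (m + p * z) - moritaGamma p m * (1 + p * A * z + p ^ 2 * B * z ^ 2) := by
  obtain ⟨w, c, hstep⟩ := moritaGamma_add_prime hp hp5 m
  obtain ⟨i, hi⟩ := (PadicInt.isUnit_two hp).exists_right_inv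
  -- Multiplying the steps `1 + p w + p ^ 2 c k` over `k < n` gives `1 + p w n + p ^ 2 (w ^ 2 + c) n
  -- (n - 1) / 2` modulo `p ^ 3`; `e` is `(w ^ 2 + c) / 2`.
  set e := i * (w ^ 2 + c) with he
  have h2e : 2 * e = w ^ 2 + c := by rw [he]; linear_combination (w ^ 2 + c) * hi
  have hnat : ∀ n : ℕ, (p : ℤ_[p]) ^ 3 ∣ moritaGamma p (m + p * n) -
      moritaGamma p m * (1 + p * (w - p * e) * n + p ^ 2 * e * n ^ 2) := by
    intro n
    induction n with
    | zero => simp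
    | succ n ih =>
      obtain ⟨u, hu⟩ := ih
      obtain ⟨v, hv⟩ := hstep n
      refine ⟨v + (1 + p * w + p ^ 2 * c * n) * u + moritaGamma p m *
        ((w * c * n ^ 2 + w * e * n * (n - 1)) + p * c * n * e * n * (n - 1)), ?_⟩
      push_cast
      linear_combination hv + (1 + p * w + p ^ 2 * c * n) * hu -
        moritaGamma p m * (p : ℤ_[p]) ^ 2 * n * h2e
  refine ⟨w - p * e, e, fun z => ?_⟩
  obtain ⟨n, hn⟩ := PadicInt.exists_natCast_sub_dvd 3 z
  obtain ⟨u, hu⟩ := hnat n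
  obtain ⟨v, hv⟩ := moritaGamma_congr hp 3 (x := m + p * z) (y := m + p * n) (by
    rw [show m + p * z - (m + p * n) = p * (z - n) by ring]; exact hn.mul_left _)
  obtain ⟨r, hr⟩ := hn
  refine ⟨u + v - moritaGamma p m * (p * (w - p * e) * r + p ^ 2 * e * r * (z + n)), ?_⟩
  linear_combination hu + hv - moritaGamma p m * (p * (w - p * e) + p ^ 2 * e * (z + n)) * hr

/-! ### Interpolation of functions that are quadratic modulo `p ^ 3`. -/

variable (p) in
/-- The functions of `(x, y)` that agree modulo `p ^ 3` with a quadratic polynomial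
in `p * x` and `p * y`. -/
def quadraticModCube : Subalgebra ℤ_[p] (ℤ_[p] × ℤ_[p] → ℤ_[p]) where
  carrier := {f | ∃ c₀ c₁ c₂ c₃ c₄ c₅ : ℤ_[p], ∀ v, (p : ℤ_[p]) ^ 3 ∣ f v -
    (c₀ + p * (c₁ * v.1 + c₂ * v.2) +
      p ^ 2 * (c₃ * v.1 ^ 2 + c₄ * (v.1 * v.2) + c₅ * v.2 ^ 2))}
  mul_mem' := by
    rintro f g ⟨c₀, c₁, c₂, c₃, c₄, c₅, hf⟩ ⟨d₀, d₁, d₂, d₃, d₄, d₅, hg⟩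
    refine ⟨c₀ * d₀, c₀ * d₁ + c₁ * d₀, c₀ * d₂ + c₂ * d₀, c₀ * d₃ + c₁ * d₁ + c₃ * d₀,
      c₀ * d₄ + c₁ * d₂ + c₂ * d₁ + c₄ * d₀, c₀ * d₅ + c₂ * d₂ + c₅ * d₀, fun v => ?_⟩
    obtain ⟨r, hr⟩ := hf v
    obtain ⟨s, hs⟩ := hg v
    obtain ⟨x, y⟩ := v
    simp only [Pi.mul_apply] at *
    refine ⟨r * g (x, y) + (c₀ + p * (c₁ * x + c₂ * y) +
        p ^ 2 * (c₃ * x ^ 2 + c₄ * (x * y) + c₅ * y ^ 2)) * s +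
      ((c₁ * x + c₂ * y) * (d₃ * x ^ 2 + d₄ * (x * y) + d₅ * y ^ 2) +
        (d₁ * x + d₂ * y) * (c₃ * x ^ 2 + c₄ * (x * y) + c₅ * y ^ 2)) +
      p * ((c₃ * x ^ 2 + c₄ * (x * y) + c₅ * y ^ 2) *
        (d₃ * x ^ 2 + d₄ * (x * y) + d₅ * y ^ 2)), ?_⟩
    linear_combination hr * g (x, y) + (c₀ + p * (c₁ * x + c₂ * y) +
        p ^ 2 * (c₃ * x ^ 2 + c₄ * (x * y) + c₅ * y ^ 2)) * hs
  add_mem' := by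
    rintro f g ⟨c₀, c₁, c₂, c₃, c₄, c₅, hf⟩ ⟨d₀, d₁, d₂, d₃, d₄, d₅, hg⟩
    refine ⟨c₀ + d₀, c₁ + d₁, c₂ + d₂, c₃ + d₃, c₄ + d₄, c₅ + d₅, fun v => ?_⟩
    have := dvd_add (hf v) (hg v)
    simp only [Pi.add_apply]
    convert this using 1
    ring
  algebraMap_mem' c := ⟨c, 0, 0, 0, 0, 0, fun v => by simp⟩

theorem linear_mem_quadraticModCube (r s t : ℤ_[p]) :
    (fun v : ℤ_[p] × ℤ_[p] => r + p * (s * v.1 + t * v.2)) ∈ quadraticModCube p :=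
  ⟨r, s, t, 0, 0, 0, fun v => by simp⟩

theorem moritaGamma_mem_quadraticModCube (hp : Odd p) (hp5 : 5 ≤ p) (r s t : ℤ_[p]) :
    (fun v : ℤ_[p] × ℤ_[p] => moritaGamma p (r + p * (s * v.1 + t * v.2))) ∈
      quadraticModCube p := by
  obtain ⟨A, B, h⟩ := moritaGamma_taylor hp hp5 r
  set g := moritaGamma p r
  refine ⟨g, g * A * s, g * A * t, g * B * s ^ 2, g * B * (2 * s * t), g * B * t ^ 2, fun v => ?_⟩
  convert h (s * v.1 + t * v.2) using 1
  ring

/-- Vanishing on the two axes kills every term except `p ^ 2 * c₄ * x * y`; the point `v₀`, where `x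
y` is a unit, kills that one. -/
theorem dvd_of_mem_quadraticModCube (hp : Odd p) {f : ℤ_[p] × ℤ_[p] → ℤ_[p]}
    (hf : f ∈ quadraticModCube p)
    (h₁ : ∀ y, (p : ℤ_[p]) ^ 3 ∣ f (0, y)) (h₂ : ∀ x, (p : ℤ_[p]) ^ 3 ∣ f (x, 0))
    {v₀ : ℤ_[p] × ℤ_[p]} (hv₀ : IsUnit (v₀.1 * v₀.2)) (h₃ : (p : ℤ_[p]) ^ 3 ∣ f v₀)
    (v : ℤ_[p] × ℤ_[p]) : (p : ℤ_[p]) ^ 3 ∣ f v := by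
  obtain ⟨c₀, c₁, c₂, c₃, c₄, c₅, h⟩ := hf
  have two := PadicInt.isUnit_two (p := p) hp
  have key : ∀ u, (p : ℤ_[p]) ^ 3 ∣ f u → (p : ℤ_[p]) ^ 3 ∣ c₀ + p * (c₁ * u.1 + c₂ * u.2) +
      p ^ 2 * (c₃ * u.1 ^ 2 + c₄ * (u.1 * u.2) + c₅ * u.2 ^ 2) := fun u hu =>
    (dvd_sub_right hu).mp (h u)
  -- On each axis the values at `0, 1, -1` determine the quadratic, since `2` is invertible.
  have e₀ := key _ (h₁ 0)
  have e₁ := key _ (h₁ 1)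
  have e₂ := key _ (h₁ (-1))
  have e₃ := key _ (h₂ 1)
  have e₄ := key _ (h₂ (-1))
  have e₅ := key _ h₃
  simp only [mul_zero, add_zero, zero_add, mul_one, one_pow, ne_eq, OfNat.ofNat_ne_zero,
    not_false_eq_true, zero_pow, zero_mul] at e₀ e₁ e₂ e₃ e₄
  have k₂ : (p : ℤ_[p]) ^ 3 ∣ p * c₂ := two.dvd_mul_left.mp (by
    convert dvd_sub e₁ e₂ using 1; ring)
  have k₅ : (p : ℤ_[p]) ^ 3 ∣ p ^ 2 * c₅ := by
    convert dvd_sub (dvd_sub e₁ e₀) k₂ using 1; ring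
  have k₁ : (p : ℤ_[p]) ^ 3 ∣ p * c₁ := two.dvd_mul_left.mp (by
    convert dvd_sub e₃ e₄ using 1; ring)
  have k₃ : (p : ℤ_[p]) ^ 3 ∣ p ^ 2 * c₃ := by
    convert dvd_sub (dvd_sub e₃ e₀) k₁ using 1; ring
  obtain ⟨r₀, q₀⟩ := e₀
  obtain ⟨r₁, q₁⟩ := k₁
  obtain ⟨r₂, q₂⟩ := k₂
  obtain ⟨r₃, q₃⟩ := k₃
  obtain ⟨r₅, q₅⟩ := k₅
  have k₄ : (p : ℤ_[p]) ^ 3 ∣ p ^ 2 * c₄ := hv₀.dvd_mul_left.mp (by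
    obtain ⟨s, hs⟩ := e₅
    refine ⟨s - r₀ - r₁ * v₀.1 - r₂ * v₀.2 - r₃ * v₀.1 ^ 2 - r₅ * v₀.2 ^ 2, ?_⟩
    linear_combination hs - q₀ - q₁ * v₀.1 - q₂ * v₀.2 - q₃ * v₀.1 ^ 2 - q₅ * v₀.2 ^ 2)
  obtain ⟨r₄, q₄⟩ := k₄
  obtain ⟨s, hs⟩ := h v
  refine ⟨s + r₀ + r₁ * v.1 + r₂ * v.2 + r₃ * v.1 ^ 2 + r₄ * (v.1 * v.2) + r₅ * v.2 ^ 2, ?_⟩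
  linear_combination hs + q₀ + q₁ * v.1 + q₂ * v.2 + q₃ * v.1 ^ 2 + q₄ * (v.1 * v.2) +
    q₅ * v.2 ^ 2

end

/-! ### The truncated sum and its exact values when a parameter is a nonpositive integer. -/

section

variable {p : ℕ} [Fact p.Prime]

theorem ascPochhammer_eval_eq_prod_range_add {R : Type*} [CommRing R] (n : ℕ) (x : R) :
    (ascPochhammer R n).eval x = ∏ i ∈ range n, (x + (i : R)) := by
  induction n with
  | zero => simp
  | succ n ih => rw [ascPochhammer_succ_eval, prod_range_succ, ih]

variable (p) in
/-- The sum `∑_{k < p} (α)_k (β)_k (γ)_k / k! ^ 3`, as a `p`-adic integer. -/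
noncomputable def truncSum (α β γ : ℤ_[p]) : ℤ_[p] :=
  ∑ k ∈ range p, (∏ i ∈ range k, (α + (i : ℤ_[p]))) * (∏ i ∈ range k, (β + (i : ℤ_[p]))) *
    (∏ i ∈ range k, (γ + (i : ℤ_[p]))) * Ring.inverse (k.factorial : ℤ_[p]) ^ 3

theorem truncSum_swap (α β γ : ℤ_[p]) : truncSum p α β γ = truncSum p β α γ :=
  sum_congr rfl fun k _ => by ring

theorem truncSum_rotate (α β γ : ℤ_[p]) : truncSum p α β γ = truncSum p γ α β :=
  sum_congr rfl fun k _ => by ring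

theorem coe_truncSum (α β γ : ℤ_[p]) :
    (truncSum p α β γ : ℚ_[p]) = ∑ k ∈ range p, (ascPochhammer ℚ_[p] k).eval (α : ℚ_[p]) *
      (ascPochhammer ℚ_[p] k).eval (β : ℚ_[p]) * (ascPochhammer ℚ_[p] k).eval (γ : ℚ_[p]) /
        (k.factorial : ℚ_[p]) ^ 3 := by
  change PadicInt.Coe.ringHom (truncSum p α β γ) = _
  rw [truncSum, map_sum]
  refine sum_congr rfl fun k hk => ?_
  have hu : IsUnit (k.factorial : ℤ_[p]) := (PadicInt.isUnit_natCast_iff _).mpr fun h =>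
    (mem_range.mp hk).not_ge (((Fact.out : p.Prime).dvd_factorial).mp h)
  have hinv : PadicInt.Coe.ringHom (Ring.inverse (k.factorial : ℤ_[p])) =
      (k.factorial : ℚ_[p])⁻¹ := by
    apply eq_inv_of_mul_eq_one_left
    rw [← map_natCast (PadicInt.Coe.ringHom (p := p)), ← map_mul, Ring.inverse_mul_cancel _ hu,
      map_one]
  simp only [map_mul, map_pow, map_prod, map_add, map_natCast, hinv,
    ascPochhammer_eval_eq_prod_range_add, div_eq_mul_inv, inv_pow]
  rfl

theorem coe_truncSum_eq_truncHypergeometric (α β : ℤ_[p]) :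
    truncHypergeometric ![(α : ℚ_[p]), (β : ℚ_[p]), 1 - (α : ℚ_[p]) - (β : ℚ_[p])] ![1, 1] 1
      (p - 1) = (truncSum p α β (1 - α - β) : ℚ_[p]) := by
  rw [coe_truncSum, truncHypergeometric, Nat.sub_add_cancel (Fact.out : p.Prime).one_le]
  refine sum_congr rfl fun k _ => ?_
  have : (k.factorial : ℚ_[p]) ≠ 0 := by exact_mod_cast k.factorial_ne_zero
  rw [Fin.prod_univ_three, Fin.prod_univ_two]
  simp only [ Matrix.cons_val_zero, Matrix.cons_val_one,
    Matrix.cons_val, ascPochhammer_eval_one, one_pow, PadicInt.coe_sub, PadicInt.coe_one]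
  field_simp

theorem truncSum_neg_natCast_mul {a : ℕ} (ha : a < p) (β : ℤ_[p]) :
    truncSum p (-(a : ℤ_[p])) β (1 + a - β) * (a.factorial : ℤ_[p]) ^ 2 =
      (∏ i ∈ range a, (1 - β + (i : ℤ_[p]))) ^ 2 := by
  have h0 : (a.factorial : ℚ_[p]) ≠ 0 := by exact_mod_cast a.factorial_ne_zero
  have h := sum_saalschutz (β : ℚ_[p]) ha
  have h' := coe_truncSum (-(a : ℤ_[p])) β (1 + a - β)
  push_cast at h'
  rw [h, ascPochhammer_eval_eq_prod_range_add] at h'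
  have hprod : ((∏ i ∈ range a, (1 - β + (i : ℤ_[p])) : ℤ_[p]) : ℚ_[p]) =
      ∏ i ∈ range a, (1 - (β : ℚ_[p]) + (i : ℚ_[p])) := by
    change PadicInt.Coe.ringHom _ = _
    simp only [map_prod, map_add, map_sub, map_one, map_natCast]
    rfl
  apply Subtype.coe_injective
  push_cast
  rw [h', hprod]
  field_simp

variable (p) in
/-- The symmetric form of the Gamma quotient when `α + β + γ = 1`. -/
noncomputable def gammaProdSq (α β γ : ℤ_[p]) : ℤ_[p] :=
  (moritaGamma p α * moritaGamma p β * moritaGamma p γ) ^ 2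

theorem gammaProdSq_swap (α β γ : ℤ_[p]) : gammaProdSq p α β γ = gammaProdSq p β α γ := by
  simp only [gammaProdSq]; ring

theorem gammaProdSq_rotate (α β γ : ℤ_[p]) : gammaProdSq p α β γ = gammaProdSq p γ α β := by
  simp only [gammaProdSq]; ring

theorem moritaGamma_one_add_natCast_sq (hp : Odd p) {a : ℕ} (ha : a < p) :
    moritaGamma p (1 + (a : ℤ_[p])) ^ 2 = (a.factorial : ℤ_[p]) ^ 2 := by
  have h1 : moritaGamma p (1 : ℤ_[p]) ^ 2 = 1 := by
    simpa [moritaGamma_zero hp] using moritaGamma_sq_mul_sq (p := p) hp 1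
  have h2 : ∏ i ∈ range a, primeToPart (1 + (i : ℤ_[p])) = a.factorial := by
    rw [← prod_range_add_one_eq_factorial]
    push_cast
    refine prod_congr rfl fun i hi => ?_
    rw [primeToPart_of_not_dvd, add_comm]
    rw [show 1 + (i : ℤ_[p]) = ((1 + i : ℕ) : ℤ_[p]) by push_cast; ring,
      PadicInt.prime_dvd_natCast_iff]
    have := mem_range.mp hi
    exact Nat.not_dvd_of_pos_of_lt (by omega) (by omega)
  rw [moritaGamma_add_natCast hp, h2, mul_pow, mul_pow, h1, ← pow_mul, mul_comm a, pow_mul]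
  simp

/-- Up to sign, the Saalschütz product is `c Γ(1 + a - β) / Γ(1 - β)` and `a!` is `Γ(1 + a)`;
reflection then removes the denominators. The constant `c` accounts for the factors divisible by
`p`, which the Gamma function skips. -/
theorem truncSum_neg_natCast (hp : Odd p) {a : ℕ} (ha : a < p) {β c : ℤ_[p]}
    (hc : ∏ i ∈ range a, (1 - β + (i : ℤ_[p])) =
      c * ∏ i ∈ range a, primeToPart (1 - β + (i : ℤ_[p]))) :
    truncSum p (-(a : ℤ_[p])) β (1 + a - β) = c ^ 2 * gammaProdSq p (-(a : ℤ_[p])) β (1 + a - β) := by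
  have h1 := truncSum_neg_natCast_mul ha β
  rw [← moritaGamma_one_add_natCast_sq hp ha, hc] at h1
  have h2 := moritaGamma_sq_mul_sq (p := p) hp (-a)
  rw [show 1 - -(a : ℤ_[p]) = 1 + a by ring] at h2
  have h3 := moritaGamma_sq_mul_sq (p := p) hp β
  have h4 := congrArg (· ^ 2) (moritaGamma_add_natCast hp (1 - β) a)
  simp only [mul_pow, ← pow_mul] at h4
  rw [show 1 - β + (a : ℤ_[p]) = 1 + a - β by ring, mul_comm a, pow_mul (-1 : ℤ_[p]), neg_one_sq,
    one_pow, one_mul] at h4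
  rw [gammaProdSq, mul_pow, mul_pow, h4]
  set T := truncSum p (-(a : ℤ_[p])) β (1 + a - β)
  set A := moritaGamma p (-(a : ℤ_[p])) ^ 2
  set B := moritaGamma p β ^ 2
  linear_combination A * h1 - T * h2 -
    A * (c * ∏ i ∈ range a, primeToPart (1 - β + (i : ℤ_[p]))) ^ 2 * h3

theorem not_dvd_natCast_sub (n : ℕ) (z : ℤ_[p]) (h : ¬ p ∣ n) :
    ¬ (p : ℤ_[p]) ∣ (n : ℤ_[p]) - p * z := by
  rw [dvd_sub_left (dvd_mul_right _ _), PadicInt.prime_dvd_natCast_iff]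
  exact h

/-- The factors are `j - p y` with `b < j ≤ a + b < p`, all prime to `p`, so `c = 1`. -/
theorem truncSum_eq_of_add_lt (hp : Odd p) {a b : ℕ} (hab : a + b < p) {α β γ y : ℤ_[p]}
    (hα : α = -(a : ℤ_[p])) (hβ : β = -b + p * y) (hγ : α + β + γ = 1) :
    truncSum p α β γ = gammaProdSq p α β γ := by
  obtain rfl : γ = 1 + a - β := by rw [hα] at hγ; linear_combination hγ
  subst hα
  rw [truncSum_neg_natCast hp (c := 1) (by omega), one_pow, one_mul]
  rw [one_mul]
  refine prod_congr rfl fun i hi => (primeToPart_of_not_dvd ?_).symm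
  have := mem_range.mp hi
  rw [show 1 - β + (i : ℤ_[p]) = ((1 + b + i : ℕ) : ℤ_[p]) - p * y by rw [hβ]; push_cast; ring]
  exact not_dvd_natCast_sub _ _ (Nat.not_dvd_of_pos_of_lt (by omega) (by omega))

/-- The factors are `j - p y` with `b < j ≤ a + b < 2 p`. Exactly one index, `j = p`, is a multiple
of `p`, and it contributes `c = p (1 - y)`. -/
theorem truncSum_eq_of_le_add (hp : Odd p) {a b : ℕ} (ha : a < p) (hb : b < p) (hab : p ≤ a + b)
    {α β γ y : ℤ_[p]} (hα : α = -(a : ℤ_[p])) (hβ : β = -b + p * y) (hγ : α + β + γ = 1) :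
    truncSum p α β γ = (p * (1 - y)) ^ 2 * gammaProdSq p α β γ := by
  obtain rfl : γ = 1 + a - β := by rw [hα] at hγ; linear_combination hγ
  subst hα
  refine truncSum_neg_natCast hp ha ?_
  have hmem : p - 1 - b ∈ range a := mem_range.mpr (by omega)
  have hβ' : ∀ i : ℕ, 1 - β + (i : ℤ_[p]) = ((1 + b + i : ℕ) : ℤ_[p]) - p * y := by
    intro i; rw [hβ]; push_cast; ring
  have h0 : 1 - β + ((p - 1 - b : ℕ) : ℤ_[p]) = p * (1 - y) := by
    rw [hβ', show 1 + b + (p - 1 - b) = p by omega]; ring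
  rw [← mul_prod_erase _ _ hmem, ← mul_prod_erase _ (fun i : ℕ => primeToPart (1 - β + (i : ℤ_[p])))
    hmem, h0, primeToPart_of_dvd (dvd_mul_right _ _), one_mul]
  congr 1
  refine prod_congr rfl fun i hi => (primeToPart_of_not_dvd ?_).symm
  obtain ⟨hne, hi⟩ := mem_erase.mp hi
  have := mem_range.mp hi
  rw [hβ']
  refine not_dvd_natCast_sub _ _ fun hd => hne ?_
  obtain ⟨k, hk⟩ := hd
  have hk1 : k = 1 := by
    have h1 : k ≠ 0 := by rintro rfl; omega
    have h2 : k < 2 := by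
      by_contra h2
      have : p * 2 ≤ p * k := Nat.mul_le_mul_left p (by omega)
      omega
    omega
  subst hk1
  omega

/-! ### The two congruences by interpolation. -/

theorem truncSum_mem_quadraticModCube (r₁ s₁ t₁ r₂ s₂ t₂ r₃ s₃ t₃ : ℤ_[p]) :
    (fun v : ℤ_[p] × ℤ_[p] => truncSum p (r₁ + p * (s₁ * v.1 + t₁ * v.2))
      (r₂ + p * (s₂ * v.1 + t₂ * v.2)) (r₃ + p * (s₃ * v.1 + t₃ * v.2))) ∈ quadraticModCube p := by
  have hprod : ∀ (r s t : ℤ_[p]) (k : ℕ),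
      (fun v : ℤ_[p] × ℤ_[p] => ∏ i ∈ range k, (r + p * (s * v.1 + t * v.2) + (i : ℤ_[p]))) ∈
        quadraticModCube p := by
    intro r s t k
    convert Subalgebra.prod_mem (quadraticModCube p) (t := range k)
      (f := fun (i : ℕ) v => (r + (i : ℤ_[p])) + p * (s * v.1 + t * v.2))
      (fun i _ => linear_mem_quadraticModCube (r + (i : ℤ_[p])) s t) using 1
    ext v
    rw [Finset.prod_apply]
    exact prod_congr rfl fun i _ => by ring
  convert Subalgebra.sum_mem (quadraticModCube p) (t := range p)
    (fun k _ => mul_mem (mul_mem (mul_mem (hprod r₁ s₁ t₁ k) (hprod r₂ s₂ t₂ k))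
      (hprod r₃ s₃ t₃ k)) ((quadraticModCube p).algebraMap_mem
        (Ring.inverse (k.factorial : ℤ_[p]) ^ 3))) using 1
  ext v
  rw [Finset.sum_apply]
  rfl

theorem truncSum_congr_of_add_lt (hp : Odd p) (hp3 : p ≠ 3) {a b : ℕ} (hab : a + b < p)
    (x y : ℤ_[p]) :
    (p : ℤ_[p]) ^ 3 ∣ truncSum p (-a + p * x) (-b + p * y) (1 + a + b - p * (x + y)) -
      gammaProdSq p (-a + p * x) (-b + p * y) (1 + a + b - p * (x + y)) := by
  have hp5 : 5 ≤ p := by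
    have := (Fact.out : p.Prime).two_le
    obtain ⟨k, rfl⟩ := hp
    omega
  let f : ℤ_[p] × ℤ_[p] → ℤ_[p] := fun v =>
    truncSum p (-a + p * (1 * v.1 + 0 * v.2)) (-b + p * (0 * v.1 + 1 * v.2))
        (1 + a + b + p * (-1 * v.1 + -1 * v.2)) -
      gammaProdSq p (-a + p * (1 * v.1 + 0 * v.2)) (-b + p * (0 * v.1 + 1 * v.2))
        (1 + a + b + p * (-1 * v.1 + -1 * v.2))
  have hf : f ∈ quadraticModCube p := by
    refine sub_mem (truncSum_mem_quadraticModCube ..) (pow_mem (mul_mem (mul_mem ?_ ?_) ?_) 2) <;>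
    exact moritaGamma_mem_quadraticModCube hp hp5 _ _ _
  have hf' : ∀ u v, f (u, v) =
      truncSum p (-a + p * u) (-b + p * v) (1 + a + b - p * (u + v)) -
        gammaProdSq p (-a + p * u) (-b + p * v) (1 + a + b - p * (u + v)) := by
    intro u v
    simp only [f]
    ring_nf
  rw [← hf']
  -- On the line `x + y = 1` the third parameter is the integer `-(p - 1 - a - b)`. The point `(2,
  -- -1)` lies on it, off the axes, and `-2` is a unit.
  refine dvd_of_mem_quadraticModCube hp hf (fun v => ?_) (fun u => ?_) (v₀ := (2, -1)) ?_ ?_ _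
  · rw [hf', truncSum_eq_of_add_lt hp hab (by ring) rfl (by ring), sub_self]
    exact dvd_zero _
  · rw [hf', truncSum_swap, gammaProdSq_swap,
      truncSum_eq_of_add_lt hp (a := b) (b := a) (by omega) (by ring) rfl (by ring), sub_self]
    exact dvd_zero _
  · simpa using PadicInt.isUnit_two (p := p) hp
  · have hc : ((p - 1 - a - b : ℕ) : ℤ_[p]) = p - 1 - a - b := by
      rw [Nat.cast_sub (by omega), Nat.cast_sub (by omega), Nat.cast_sub (by omega)]; simp
    rw [hf', truncSum_rotate, gammaProdSq_rotate,
      truncSum_eq_of_add_lt hp (a := p - 1 - a - b) (b := a) (by omega) (by rw [hc]; ring) rfl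
        (by ring), sub_self]
    exact dvd_zero _

theorem gammaProdSq_congr (hp : Odd p) (N : ℕ) {α β γ α' β' γ' : ℤ_[p]}
    (hα : (p : ℤ_[p]) ^ N ∣ α - α') (hβ : (p : ℤ_[p]) ^ N ∣ β - β')
    (hγ : (p : ℤ_[p]) ^ N ∣ γ - γ') :
    (p : ℤ_[p]) ^ N ∣ gammaProdSq p α β γ - gammaProdSq p α' β' γ' := by
  have h1 := moritaGamma_congr hp N hα
  have h2 := moritaGamma_congr hp N hβ
  have h3 := moritaGamma_congr hp N hγ
  simp only [← Ideal.mem_span_singleton, ← Ideal.Quotient.eq] at h1 h2 h3 ⊢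
  simp only [gammaProdSq, map_pow, map_mul, h1, h2, h3]

/-- Because of the factor `p ^ 2`, the Gamma product matters only modulo `p` and may be replaced by
the constant `g`. No Taylor expansion is needed, so `p = 3` is allowed. -/
theorem truncSum_congr_of_le_add (hp : Odd p) {a b : ℕ} (ha : a < p) (hb : b < p)
    (hab : p ≤ a + b) (x y : ℤ_[p]) :
    (p : ℤ_[p]) ^ 3 ∣ truncSum p (-a + p * x) (-b + p * y) (1 + a + b - p * (x + y)) -
      p ^ 2 * ((x - 1) ^ 2 + (y - 1) ^ 2 + x * y - 1) *
        gammaProdSq p (-a + p * x) (-b + p * y) (1 + a + b - p * (x + y)) := by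
  set g : ℤ_[p] := gammaProdSq p (-(a : ℤ_[p])) (-b) (1 + a + b) with hg
  have hG : ∀ u v : ℤ_[p], (p : ℤ_[p]) ∣
      gammaProdSq p (-a + p * u) (-b + p * v) (1 + a + b - p * (u + v)) - g := by
    intro u v
    have := gammaProdSq_congr hp 1 (α := -a + p * u) (β := -b + p * v)
      (γ := 1 + a + b - p * (u + v)) (α' := -a) (β' := -b) (γ' := 1 + a + b)
      (by simp) (by simp) (by simp)
    rwa [pow_one] at this
  let f : ℤ_[p] × ℤ_[p] → ℤ_[p] := fun v =>
    truncSum p (-a + p * (1 * v.1 + 0 * v.2)) (-b + p * (0 * v.1 + 1 * v.2))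
        (1 + a + b + p * (-1 * v.1 + -1 * v.2)) -
      p ^ 2 * ((v.1 - 1) ^ 2 + (v.2 - 1) ^ 2 + v.1 * v.2 - 1) * g
  have hf : f ∈ quadraticModCube p := by
    refine sub_mem (truncSum_mem_quadraticModCube ..)
      -- The coefficients of `1 - 2 x - 2 y + x ^ 2 + x y + y ^ 2`, which is the expanded bracket.
      ⟨p ^ 2 * g, -2 * p * g, -2 * p * g, g, g, g, fun v => ⟨0, ?_⟩⟩
    ring
  have hf' : ∀ u v, f (u, v) =
      truncSum p (-a + p * u) (-b + p * v) (1 + a + b - p * (u + v)) -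
        p ^ 2 * ((u - 1) ^ 2 + (v - 1) ^ 2 + u * v - 1) * g := by
    intro u v
    simp only [f]
    ring_nf
  have main : (p : ℤ_[p]) ^ 3 ∣ f (x, y) := by
    -- The bracket restricts to `(1 - y) ^ 2` and `(1 - x) ^ 2` on the axes, as the exact
    -- evaluations require. At `(1, 1)` the third parameter is `-(2 p - 1 - a - b)`, and both the
    -- sum and the bracket are zero.
    refine dvd_of_mem_quadraticModCube hp hf (fun v => ?_) (fun u => ?_) (v₀ := (1, 1)) ?_ ?_ _
    · rw [hf', truncSum_eq_of_le_add hp ha hb hab (by ring) rfl (by ring)]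
      obtain ⟨r, hr⟩ := hG 0 v
      exact ⟨(1 - v) ^ 2 * r, by linear_combination (p : ℤ_[p]) ^ 2 * (1 - v) ^ 2 * hr⟩
    · rw [hf', truncSum_swap, truncSum_eq_of_le_add hp hb ha (by omega) (by ring) rfl (by ring),
        gammaProdSq_swap]
      obtain ⟨r, hr⟩ := hG u 0
      exact ⟨(1 - u) ^ 2 * r, by linear_combination (p : ℤ_[p]) ^ 2 * (1 - u) ^ 2 * hr⟩
    · simp
    · have hc : ((2 * p - 1 - a - b : ℕ) : ℤ_[p]) = 2 * p - 1 - a - b := by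
        rw [Nat.cast_sub (by omega), Nat.cast_sub (by omega), Nat.cast_sub (by omega)]; simp
      rw [hf', truncSum_rotate, truncSum_eq_of_le_add hp (a := 2 * p - 1 - a - b) (b := a)
        (by omega) ha (by omega) (by rw [hc]; ring) rfl (by ring)]
      simp
  obtain ⟨r, hr⟩ := main
  obtain ⟨s, hs⟩ := hG x y
  rw [hf'] at hr
  refine ⟨r - ((x - 1) ^ 2 + (y - 1) ^ 2 + x * y - 1) * s, ?_⟩
  linear_combination hr - p ^ 2 * ((x - 1) ^ 2 + (y - 1) ^ 2 + x * y - 1) * hs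

/-! ### Translation back to the original statement in `ℚ_[p]`. -/

theorem coe_gammaProdSq (hp : Odd p) (α β : ℤ_[p]) :
    (moritaGamma p (1 - α - β) : ℚ_[p]) ^ 2 /
      ((moritaGamma p (1 - α) : ℚ_[p]) ^ 2 * (moritaGamma p (1 - β) : ℚ_[p]) ^ 2) =
      (gammaProdSq p α β (1 - α - β) : ℚ_[p]) := by
  have h1 : (moritaGamma p α : ℚ_[p]) ^ 2 * (moritaGamma p (1 - α) : ℚ_[p]) ^ 2 = 1 := by
    exact_mod_cast congrArg (Subtype.val) (moritaGamma_sq_mul_sq hp α)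
  have h2 : (moritaGamma p β : ℚ_[p]) ^ 2 * (moritaGamma p (1 - β) : ℚ_[p]) ^ 2 = 1 := by
    exact_mod_cast congrArg (Subtype.val) (moritaGamma_sq_mul_sq hp β)
  have hne : (moritaGamma p (1 - α) : ℚ_[p]) ^ 2 * (moritaGamma p (1 - β) : ℚ_[p]) ^ 2 ≠ 0 :=
    mul_ne_zero (right_ne_zero_of_mul_eq_one h1) (right_ne_zero_of_mul_eq_one h2)
  rw [div_eq_iff hne, gammaProdSq]
  push_cast
  linear_combination -(moritaGamma p (1 - α - β) : ℚ_[p]) ^ 2 * h1 -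
    (moritaGamma p (1 - α - β) : ℚ_[p]) ^ 2 * (moritaGamma p α : ℚ_[p]) ^ 2 *
      (moritaGamma p (1 - α) : ℚ_[p]) ^ 2 * h2

/-- Identifies `α*` and `β*` with the interpolation coordinates `x` and `y`. -/
theorem exists_padicDash_eq (x : ℤ_[p]) :
    ∃ z : ℤ_[p], x = -((-x).zmodRepr : ℤ_[p]) + p * z ∧ padicDash x = z := by
  have h := PadicInt.sub_zmodRepr_mem (-x)
  rw [PadicInt.maximalIdeal_eq_span_p, Ideal.mem_span_singleton] at h
  obtain ⟨z, hz⟩ := h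
  have hx : x = -((-x).zmodRepr : ℤ_[p]) + p * -z := by linear_combination -hz
  refine ⟨-z, hx, ?_⟩
  have hp0 : (p : ℚ_[p]) ≠ 0 := by exact_mod_cast (Fact.out : p.Prime).ne_zero
  have hx' := congrArg (Subtype.val) hx
  push_cast at hx'
  rw [padicDash, div_eq_iff hp0]
  push_cast
  linear_combination hx'

theorem PadicCongrMod.of_dvd {n : ℕ} {x y : ℤ_[p]} (h : (p : ℤ_[p]) ^ n ∣ x - y) :
    PadicCongrMod n (x : ℚ_[p]) (y : ℚ_[p]) := by
  obtain ⟨z, hz⟩ := h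
  exact ⟨z, by exact_mod_cast congrArg (Subtype.val) hz⟩

end

theorem theorem7p1 (p : ℕ) [Fact p.Prime] (hp : Odd p) (α β : ℤ_[p]) :
    (p ≠ 3 → (-α).zmodRepr + (-β).zmodRepr ≤ p - 1 →
      PadicCongrMod 3
        (truncHypergeometric ![(α : ℚ_[p]), (β : ℚ_[p]), 1 - (α : ℚ_[p]) - (β : ℚ_[p])] ![1, 1] 1 (p - 1))
        ((moritaGamma p (1 - α - β) : ℚ_[p]) ^ 2 /
          ((moritaGamma p (1 - α) : ℚ_[p]) ^ 2 * (moritaGamma p (1 - β) : ℚ_[p]) ^ 2))) ∧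
    (p ≤ (-α).zmodRepr + (-β).zmodRepr →
      PadicCongrMod 3
        (truncHypergeometric ![(α : ℚ_[p]), (β : ℚ_[p]), 1 - (α : ℚ_[p]) - (β : ℚ_[p])] ![1, 1] 1 (p - 1))
        ((p : ℚ_[p]) ^ 2 *
          ((padicDash α - 1) ^ 2 + (padicDash β - 1) ^ 2 + padicDash α * padicDash β - 1) *
          ((moritaGamma p (1 - α - β) : ℚ_[p]) ^ 2 /
            ((moritaGamma p (1 - α) : ℚ_[p]) ^ 2 * (moritaGamma p (1 - β) : ℚ_[p]) ^ 2)))) := by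
  have hpos := (Fact.out : p.Prime).pos
  obtain ⟨x, hx, hx'⟩ := exists_padicDash_eq α
  obtain ⟨y, hy, hy'⟩ := exists_padicDash_eq β
  have ha := PadicInt.zmodRepr_lt_p (-α)
  have hb := PadicInt.zmodRepr_lt_p (-β)
  rw [coe_truncSum_eq_truncHypergeometric, coe_gammaProdSq hp, hx', hy']
  generalize (-α).zmodRepr = a at *
  generalize (-β).zmodRepr = b at *
  have hγ : 1 - α - β = 1 + a + b - p * (x + y) := by rw [hx, hy]; ring
  rw [hγ, hx, hy]
  refine ⟨fun hp3 hab => PadicCongrMod.of_dvd (truncSum_congr_of_add_lt hp hp3 (by omega) x y),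
    fun hab => ?_⟩
  exact_mod_cast PadicCongrMod.of_dvd (truncSum_congr_of_le_add hp ha hb hab x y)
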